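/- Let $(\Omega,\mathcal F,\mathbb P)$ be a probability space. Let $T^f=(T^f(t))_{t\ge 0}$ be a subordinator, i.e. a nondecreasing process with $T^f(0)=0$ a.s., stationary and independent increments and right-continuous paths with finite left limits, whose Laplace transform is $\mathbb E\,e^{-uT^f(t)}=e^{-tf(u)}$ ($t,u\ge 0$) with $$f(u)=\int_{(0,\infty)}(1-e^{-ux})\,\nu(dx),$$ where $\nu$ is a measure on $(0,\infty)$ with $\int_{(0,\infty)}\min\{1,x\}\,\nu(dx)<\infty$ and $\nu(0,\infty)=\infty$. Let $S^f(t)=\inf\{\tau>0: T^f(\tau)>t\}$, $t\ge 0$, be its inverse, let $B=(B(t))_{t\ge0}$ be a standard one-dimensional Brownian motion with continuous paths, independent of $S^f$, and let $X(t)=B(S^f(t))$. Put $$\mathcal F_t=\bigcap_{u>t}\sigma\big(\{B(y):0\le y\le u\},\{S^f(r):r\ge0\}\big),\qquad \mathcal G_t=\mathcal F_{S^f(t)},$$ where $\mathcal F_{S^f(t)}$ is the $\sigma$-algebra of the $(\mathcal F_u)$-stopping time $S^f(t)$. (i) Both $X(t)$ and $\exp\{X(t)-\tfrac12 S^f(t)\}$,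 $t\ge 0$, are martingales with respect to $(\mathcal G_t)_{t\ge0}$ and $\mathbb P$. (ii) Let $T\ge 0$ and $\epsilon\ge 0$. Then $$c_\epsilon^{-1}=\int_\Omega \exp\{-\tfrac12X(T)-(\epsilon+\tfrac18)S^f(T)\}\,d\mathbb P\in(0,\infty),$$ and $\exp\{X(t)\}$, $t\in[0,T]$, is a martingale with respect to $(\mathcal G_t)_{t\in[0,T]}$ and the probability measure $$\mathbb P_\epsilon(A)=c_\epsilon\int_A\exp\{-\tfrac12X(T)-(\epsilon+\tfrac18)S^f(T)\}\,d\mathbb P,\qquad A\in\mathcal F.$$ -/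

import Mathlib

open MeasureTheory ProbabilityTheory
open scoped NNReal ENNReal

namespace Subdiffusion

variable {Ω : Type*} {mΩ : MeasurableSpace Ω}

/-- A standard one-dimensional Brownian motion: measurable coordinates, Gaussian finite-dimensional
laws with covariance `min s t`, and continuous sample paths. -/
structure IsBrownianMotion (B : ℝ≥0 → Ω → ℝ) (P : Measure Ω) : Prop where
  measurable : ∀ t, Measurable (B t)
  isPreBrownian : IsPreBrownianReal B P
  continuous_path : ∀ ω, Continuous fun t => B t ω

/-- A Lévy measure `ν` of a subordinator: a measure supported in `(0, ∞)` such that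
`∫_{(0, ∞)} min {1, x} ν(dx) < ∞`. -/
structure IsSubordinatorLevyMeasure (ν : Measure ℝ) : Prop where
  support_pos : ν (Set.Iic 0) = 0
  lintegral_min_lt_top : ∫⁻ x in Set.Ioi 0, ENNReal.ofReal (min 1 x) ∂ν < ∞

/-- The driftless Bernstein function `f(u) = ∫_{(0, ∞)} (1 - e^{-ux}) ν(dx)`. -/
noncomputable def laplaceExponent (ν : Measure ℝ) (u : ℝ) : ℝ :=
  ∫ x in Set.Ioi 0, (1 - Real.exp (-(u * x))) ∂ν

/-- A subordinator: a Lévy process (stationary and independent increments, càdlàg paths, started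
at zero) with almost surely nondecreasing paths. -/
structure IsSubordinator (T : ℝ≥0 → Ω → ℝ) (P : Measure Ω) : Prop where
  measurable : ∀ t, Measurable (T t)
  zero_ae : ∀ᵐ ω ∂P, T 0 ω = 0
  indep_increments : HasIndepIncrements T P
  stationary_increments : ∀ s t h : ℝ≥0,
    IdentDistrib (fun ω => T (s + h) ω - T s ω) (fun ω => T (t + h) ω - T t ω) P P
  right_continuous : ∀ ω t, ContinuousWithinAt (fun s => T s ω) (Set.Ioi t) t
  left_limits : ∀ ω t, ∃ l : ℝ,
    Filter.Tendsto (fun s => T s ω) (nhdsWithin t (Set.Iio t)) (nhds l)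
  monotone_ae : ∀ᵐ ω ∂P, Monotone fun t => T t ω

/-- `T` has Laplace exponent `f`, i.e. `E e^{-u T(t)} = e^{-t f(u)}` for all `t, u ≥ 0`. -/
def HasLaplaceExponent (T : ℝ≥0 → Ω → ℝ) (f : ℝ → ℝ) (P : Measure Ω) : Prop :=
  ∀ (t : ℝ≥0) (u : ℝ), 0 ≤ u →
    ∫ ω, Real.exp (-(u * T t ω)) ∂P = Real.exp (-(t * f u))

/-- The first-passage time `S(t) = inf {τ > 0 : T(τ) > t}`, with `inf ∅ = ∞`. -/
noncomputable def firstPassage (T : ℝ≥0 → Ω → ℝ) (t : ℝ≥0) (ω : Ω) : ℝ≥0∞ :=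
  ⨅ (τ : ℝ≥0) (_ : 0 < τ ∧ (t : ℝ) < T τ ω), (τ : ℝ≥0∞)

/-- The inverse subordinator as a finite-valued process (it differs from `firstPassage` only where
the latter is infinite, which happens with probability zero for a nontrivial subordinator). -/
noncomputable def inverseSubordinator (T : ℝ≥0 → Ω → ℝ) (t : ℝ≥0) (ω : Ω) : ℝ≥0 :=
  (firstPassage T t ω).toNNReal

/-- The subdiffusion process `X(t) = B(S(t))`. -/
noncomputable def subdiffusion (B T : ℝ≥0 → Ω → ℝ) (t : ℝ≥0) (ω : Ω) : ℝ :=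
  B (inverseSubordinator T t ω) ω

lemma firstPassage_mono (T : ℝ≥0 → Ω → ℝ) {s t : ℝ≥0} (h : s ≤ t) (ω : Ω) :
    firstPassage T s ω ≤ firstPassage T t ω := by
  refine le_iInf₂ fun τ hτ => iInf₂_le τ ⟨hτ.1, lt_of_le_of_lt ?_ hτ.2⟩
  exact_mod_cast h

lemma measurable_firstPassage {T : ℝ≥0 → Ω → ℝ} (hm : ∀ t, Measurable (T t))
    (hr : ∀ ω t, ContinuousWithinAt (fun s => T s ω) (Set.Ioi t) t) (t : ℝ≥0) :
    Measurable (firstPassage T t) := by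
  obtain ⟨D, hDc, hD⟩ := TopologicalSpace.exists_countable_dense ℝ≥0
  refine measurable_of_Iio fun a => ?_
  have : firstPassage T t ⁻¹' Set.Iio a =
      ⋃ q ∈ D, {ω | (0 < q ∧ (q : ℝ≥0∞) < a) ∧ (t : ℝ) < T q ω} := by
    ext ω
    simp only [Set.mem_preimage, Set.mem_Iio, firstPassage, iInf_lt_iff, Set.mem_iUnion,
      exists_prop, Set.mem_ofPred_eq]
    constructor
    · rintro ⟨τ, ⟨h0, hT⟩, ha⟩
      have h1 : ∀ᶠ s in nhdsWithin τ (Set.Ioi τ), (t : ℝ) < T s ω :=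
        (hr ω τ).eventually (lt_mem_nhds hT)
      have h2 : ∀ᶠ s : ℝ≥0 in nhdsWithin τ (Set.Ioi τ), (s : ℝ≥0∞) < a :=
        Filter.Eventually.filter_mono nhdsWithin_le_nhds
          (ENNReal.continuous_coe.continuousAt.eventually (gt_mem_nhds ha))
      obtain ⟨b, hb, hsub⟩ := (mem_nhdsGT_iff_exists_Ioo_subset).1 (h1.and h2)
      obtain ⟨q, hqD, hq⟩ := hD.exists_mem_open isOpen_Ioo (Set.nonempty_Ioo.2 hb)
      exact ⟨q, hqD, ⟨h0.trans hq.1, (hsub hq).2⟩, (hsub hq).1⟩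
    · rintro ⟨q, -, ⟨h0, ha⟩, hT⟩
      exact ⟨q, ⟨h0, hT⟩, ha⟩
  rw [this]
  refine MeasurableSet.biUnion hDc fun q _ => ?_
  exact (MeasurableSet.const _).inter (measurableSet_lt measurable_const (hm q))

/-- The filtration `t ↦ σ({B(y) : 0 ≤ y ≤ t}, {S(r) : r ≥ 0})`. -/
def enlargedFiltration (B : ℝ≥0 → Ω → ℝ) (S : ℝ≥0 → Ω → ℝ≥0∞)
    (hB : ∀ t, Measurable (B t)) (hS : ∀ t, Measurable (S t)) : Filtration ℝ≥0 mΩ where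
  seq t := (⨆ y ≤ t, MeasurableSpace.comap (B y) inferInstance) ⊔
    ⨆ r, MeasurableSpace.comap (S r) inferInstance
  mono' _ _ h := sup_le_sup_right (biSup_mono fun _ hy => hy.trans h) _
  le' _ := sup_le (iSup₂_le fun y _ => (hB y).comap_le) (iSup_le fun r => (hS r).comap_le)

/-- The right-continuous filtration
`𝓕_t = ⋂_{u > t} σ({B(y) : 0 ≤ y ≤ u}, {S(r) : r ≥ 0})`. -/
noncomputable def baseFiltration (B : ℝ≥0 → Ω → ℝ) (S : ℝ≥0 → Ω → ℝ≥0∞)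
    (hB : ∀ t, Measurable (B t)) (hS : ∀ t, Measurable (S t)) : Filtration ℝ≥0 mΩ :=
  (enlargedFiltration B S hB hS).rightCont

lemma isStoppingTime_baseFiltration (B : ℝ≥0 → Ω → ℝ) (S : ℝ≥0 → Ω → ℝ≥0∞)
    (hB : ∀ t, Measurable (B t)) (hS : ∀ t, Measurable (S t)) (t : ℝ≥0) :
    IsStoppingTime (baseFiltration B S hB hS) (S t) := by
  intro i
  refine (enlargedFiltration B S hB hS).le_rightCont i _ ?_
  have h : MeasurableSpace.comap (S t) inferInstance ≤ enlargedFiltration B S hB hS i :=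
    le_sup_of_le_right (le_iSup (fun r => MeasurableSpace.comap (S r) inferInstance) t)
  exact h _ ⟨Set.Iic (i : ℝ≥0∞), measurableSet_Iic, rfl⟩

/-- The time-changed filtration `𝓖_t = 𝓕_{S(t)}`, where `S` is the first-passage process of `T`. -/
noncomputable def timeChangedFiltration {B T : ℝ≥0 → Ω → ℝ} {P : Measure Ω}
    (hB : IsBrownianMotion B P) (hT : IsSubordinator T P) : Filtration ℝ≥0 mΩ where
  seq t := (isStoppingTime_baseFiltration B (firstPassage T) hB.measurable
    (measurable_firstPassage hT.measurable hT.right_continuous) t).measurableSpace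
  mono' _ _ h := IsStoppingTime.measurableSpace_mono _ _ fun ω => firstPassage_mono T h ω
  le' _ := IsStoppingTime.measurableSpace_le _

/-- The restriction of a filtration to the time interval `[0, a]`. -/
def restrictIcc (𝓗 : Filtration ℝ≥0 mΩ) (a : ℝ≥0) : Filtration (Set.Icc (0 : ℝ≥0) a) mΩ where
  seq t := 𝓗 t
  mono' _ _ h := 𝓗.mono h
  le' t := 𝓗.le t

/-- The probability measure
`P_ε(A) = c_ε ∫_A exp {-X(a)/2 - (ε + 1/8) S(a)} dP`, with `c_ε` the normalizing constant. -/
noncomputable def tiltedMeasure (P : Measure Ω) (B T : ℝ≥0 → Ω → ℝ) (a : ℝ≥0) (ε : ℝ) :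
    Measure Ω :=
  P.tilted fun ω =>
    -(1 / 2) * subdiffusion B T a ω - (ε + 1 / 8) * (inverseSubordinator T a ω : ℝ)

end Subdiffusion

/-! Write `S` for the first-passage process of `T`. Since `B` is independent of `S`, putting all of
`S` into the initial information leaves `B` a Brownian motion: `B` and every `exp (θ B(u) - θ² u /
2)` remain martingales for the enlarged filtration, and each `S(t)` becomes a stopping time. The
martingales of part (i) are these processes sampled at `S(t)`, so optional sampling is the main tool
(`integrableOn_and_setIntegral_eval_toNNReal_eq`). `S(t)` is unbounded, but `{S(t) < n}` belongs to
every `𝓖_s`. Sampling is therefore done on these events and `n → ∞` follows by integrability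
(`setIntegral_eval_toNNReal_eq`).

Integrability of the exponentials comes from monotone convergence, the mass on `{S(t) < n}` being at
most `1`. For `X(t)` it comes from an exponential moment of `S(t)`: a Chernoff bound gives `P(S(t) >
n) ≤ exp (t - n f(1))`, with `f(1) > 0`.

For part (ii), let `Z^θ(t) = exp (θ X(t) - θ² S(t) / 2)`. The tilting density is proportional to
`Z^{-1/2}(a) exp (-ε S(a))`, where `S(a)` is known to every `𝓖_t`. On an event of `𝓖_t` the
martingale property replaces `Z^{-1/2}(a)` by `Z^{-1/2}(t)`. Then `Z^{-1/2}(t) exp (X(t)) =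
Z^{1/2}(t)`, which is replaced by `Z^{1/2}(a)`. The resulting integral no longer involves `t`
(`setLIntegral_tilt_mul_exp_eq`), and this is the martingale property of `exp (X(t))` under the
tilted measure. -/

namespace Subdiffusion

open Filter Topology

variable {Ω : Type*} {mΩ : MeasurableSpace Ω}

/-! ### Optional sampling at stopping times of the right-continuous filtration. -/

section OptionalSampling

/-- An event of the σ-algebra of an `𝓕₊`-stopping time `σ`, intersected with `{σ < r}`, is known
to the filtration `𝓕` at time `r`. -/
lemma measurableSet_inter_lt_of_rightCont {𝓕 : Filtration ℝ≥0 mΩ} {σ : Ω → ℝ≥0∞}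
    (hσ : IsStoppingTime 𝓕.rightCont σ) {A : Set Ω} (hA : MeasurableSet[hσ.measurableSpace] A)
    (r : ℝ≥0) : MeasurableSet[𝓕 r] (A ∩ {ω | σ ω < r}) := by
  obtain ⟨D, hDc, hD⟩ := TopologicalSpace.exists_countable_dense ℝ≥0
  have h : A ∩ {ω | σ ω < r} = ⋃ q ∈ D ∩ Set.Iio r, A ∩ {ω | σ ω ≤ (q : ℝ≥0∞)} := by
    ext ω
    simp only [Set.mem_inter_iff, Set.mem_ofPred_eq, Set.mem_iUnion, Set.mem_Iio, exists_prop]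
    constructor
    · rintro ⟨hωA, hlt⟩
      lift σ ω to ℝ≥0 using (hlt.trans ENNReal.coe_lt_top).ne with x
      obtain ⟨q, hqD, hq⟩ := hD.exists_between (ENNReal.coe_lt_coe.1 hlt)
      exact ⟨q, ⟨hqD, hq.2⟩, hωA, ENNReal.coe_le_coe.2 hq.1.le⟩
    · rintro ⟨q, ⟨-, hq⟩, hωA, hle⟩
      exact ⟨hωA, hle.trans_lt (ENNReal.coe_lt_coe.2 hq)⟩
  rw [h]
  refine MeasurableSet.biUnion (hDc.mono Set.inter_subset_left) fun q hq => ?_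
  have h1 := hA.2 q
  rw [Filtration.rightCont_eq] at h1
  exact (iInf₂_le r hq.2 : (⨅ j > q, 𝓕 j) ≤ 𝓕 r) _ h1

/-- The time `min ((⌊(n + 1) σ⌋ + 1) / (n + 1)) N`, discretizing `σ` strictly from above. -/
noncomputable def discretizedTime (σ : Ω → ℝ≥0∞) (N : ℝ≥0) (n : ℕ) (ω : Ω) : ℝ≥0 :=
  if σ ω < N then min ((⌊((n : ℝ≥0) + 1) * (σ ω).toNNReal⌋₊ + 1) / ((n : ℝ≥0) + 1)) N else N

lemma discretizedTime_le (σ : Ω → ℝ≥0∞) (N : ℝ≥0) (n : ℕ) (ω : Ω) :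
    discretizedTime σ N n ω ≤ N := by
  unfold discretizedTime
  split_ifs
  · exact min_le_right _ _
  · exact le_rfl

/-- Rounding strictly upwards turns the event into a strict inequality for `σ` at a grid point not
exceeding `i`. Such an event lies in `𝓕 i` itself, not just in its right limit. -/
lemma discretizedTime_le_iff (σ : Ω → ℝ≥0∞) {N : ℝ≥0} (n : ℕ) {i : ℝ≥0} (hi : i < N) (ω : Ω) :
    discretizedTime σ N n ω ≤ i ↔
      σ ω < ((⌊((n : ℝ≥0) + 1) * i⌋₊ / ((n : ℝ≥0) + 1) : ℝ≥0) : ℝ≥0∞) := by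
  have hn : (0 : ℝ≥0) < (n : ℝ≥0) + 1 := by positivity
  have hfl : (⌊((n : ℝ≥0) + 1) * i⌋₊ / ((n : ℝ≥0) + 1) : ℝ≥0) ≤ i := by
    rw [div_le_iff₀ hn, mul_comm i]
    exact Nat.floor_le zero_le
  unfold discretizedTime
  split_ifs with h
  · rw [min_le_iff, or_iff_left hi.not_ge]
    lift σ ω to ℝ≥0 using (h.trans ENNReal.coe_lt_top).ne with x
    rw [ENNReal.toNNReal_coe, ENNReal.coe_lt_coe, lt_div_iff₀ hn, div_le_iff₀ hn, mul_comm x,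
      mul_comm i, ← Nat.floor_lt zero_le, Nat.lt_iff_add_one_le, Nat.le_floor_iff zero_le]
    push_cast
    rfl
  -- When `σ ≥ N` both sides fail: the discretized time is `N > i`, and the grid point is below `N`.
  · refine iff_of_false hi.not_ge fun h' => h (h'.trans ?_)
    exact ENNReal.coe_lt_coe.2 (hfl.trans_lt hi)

lemma countable_range_discretizedTime (σ : Ω → ℝ≥0∞) (N : ℝ≥0) (n : ℕ) :
    (Set.range (discretizedTime σ N n)).Countable := by
  refine ((Set.countable_range fun k : ℕ => min (((k : ℝ≥0) + 1) / ((n : ℝ≥0) + 1)) N).union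
    (Set.countable_singleton N)).mono ?_
  rintro _ ⟨ω, rfl⟩
  unfold discretizedTime
  split_ifs
  · exact Or.inl ⟨_, rfl⟩
  · exact Or.inr rfl

lemma tendsto_discretizedTime (σ : Ω → ℝ≥0∞) (N : ℝ≥0) (ω : Ω) :
    Tendsto (fun n => discretizedTime σ N n ω) atTop (𝓝 (min (σ ω) N).toNNReal) := by
  by_cases h : σ ω < N
  · have h0 : (min (σ ω) N).toNNReal = min (σ ω).toNNReal N := by
      rw [min_eq_left h.le, min_eq_left]
      simpa using ENNReal.toNNReal_mono ENNReal.coe_ne_top h.le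
    simp only [discretizedTime, if_pos h, h0]
    refine Tendsto.min ?_ tendsto_const_nhds
    set x := (σ ω).toNNReal
    have hlim : Tendsto (fun n : ℕ => x + 1 / ((n : ℝ≥0) + 1)) atTop (𝓝 x) := by
      simpa using (tendsto_const_nhds (x := x)).add
        (tendsto_one_div_add_atTop_nhds_zero_nat (𝕜 := ℝ≥0))
    refine tendsto_of_tendsto_of_tendsto_of_le_of_le tendsto_const_nhds hlim (fun n => ?_)
      fun n => ?_
    · have hn : (0 : ℝ≥0) < (n : ℝ≥0) + 1 := by positivity
      change x ≤ _
      rw [le_div_iff₀ hn, mul_comm]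
      exact (Nat.lt_floor_add_one _).le
    · have hn : (0 : ℝ≥0) < (n : ℝ≥0) + 1 := by positivity
      change _ ≤ x + 1 / ((n : ℝ≥0) + 1)
      rw [div_le_iff₀ hn, add_mul x, one_div, inv_mul_cancel₀ hn.ne', mul_comm x]
      gcongr
      exact Nat.floor_le zero_le
  · simp [discretizedTime, if_neg h, min_eq_right (not_lt.1 h)]

/-- Being a stopping time of `𝓕` means that `M` need only be a martingale for `𝓕`, not for its
right-continuous version. -/
lemma isStoppingTime_discretizedTime {𝓕 : Filtration ℝ≥0 mΩ} {σ : Ω → ℝ≥0∞}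
    (hσ : IsStoppingTime 𝓕.rightCont σ) (N : ℝ≥0) (n : ℕ) :
    IsStoppingTime 𝓕 (fun ω => ((discretizedTime σ N n ω : ℝ≥0) : WithTop ℝ≥0)) := by
  intro i
  simp only [WithTop.coe_le_coe]
  rcases le_or_gt N i with hi | hi
  · simp [(discretizedTime_le σ N n _).trans hi]
  · simp only [discretizedTime_le_iff σ n hi]
    have h := measurableSet_inter_lt_of_rightCont hσ (A := Set.univ) MeasurableSet.univ
      (⌊((n : ℝ≥0) + 1) * i⌋₊ / ((n : ℝ≥0) + 1))
    rw [Set.univ_inter] at h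
    refine 𝓕.mono ?_ _ h
    rw [div_le_iff₀ (by positivity), mul_comm i]
    exact Nat.floor_le zero_le

lemma measurableSet_discretizedTime {𝓕 : Filtration ℝ≥0 mΩ} {σ : Ω → ℝ≥0∞}
    (hσ : IsStoppingTime 𝓕.rightCont σ) {N : ℝ≥0} (n : ℕ) {A : Set Ω}
    (hA : MeasurableSet[hσ.measurableSpace] A) (hAN : A ⊆ {ω | σ ω < N}) :
    MeasurableSet[(isStoppingTime_discretizedTime hσ N n).measurableSpace] A := by
  have hN : MeasurableSet[𝓕 N] A := by
    simpa [Set.inter_eq_left.2 hAN] using measurableSet_inter_lt_of_rightCont hσ hA N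
  refine ⟨le_iSup 𝓕 N _ hN, fun i => ?_⟩
  simp only [WithTop.coe_le_coe]
  rcases le_or_gt N i with hi | hi
  · simpa [(discretizedTime_le σ N n _).trans hi] using 𝓕.mono hi _ hN
  · simp only [discretizedTime_le_iff σ n hi]
    refine 𝓕.mono ?_ _ (measurableSet_inter_lt_of_rightCont hσ hA _)
    rw [div_le_iff₀ (by positivity), mul_comm i]
    exact Nat.floor_le zero_le

/-- **Optional sampling** for a continuous martingale and a stopping time `σ` of the
right-continuous filtration, on an event contained in `{σ < N}`. -/
theorem integrableOn_and_setIntegral_eval_toNNReal_eq {P : Measure Ω} [IsProbabilityMeasure P]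
    {𝓕 : Filtration ℝ≥0 mΩ} {M : ℝ≥0 → Ω → ℝ} (hM : Martingale M 𝓕 P)
    (hMc : ∀ ω, Continuous fun t => M t ω) {σ : Ω → ℝ≥0∞}
    (hσ : IsStoppingTime 𝓕.rightCont σ) {N : ℝ≥0} {A : Set Ω}
    (hA : MeasurableSet[hσ.measurableSpace] A) (hAN : A ⊆ {ω | σ ω < N}) :
    IntegrableOn (fun ω => M (σ ω).toNNReal ω) A P ∧
      ∫ ω in A, M (σ ω).toNNReal ω ∂P = ∫ ω in A, M N ω ∂P := by
  have hst := isStoppingTime_discretizedTime hσ N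
  have hle n : (hst n).measurableSpace ≤ mΩ := (hst n).measurableSpace_le
  have hA' : MeasurableSet A := hσ.measurableSpace_le _ hA
  set f : ℕ → Ω → ℝ := fun n ω => M (discretizedTime σ N n ω) ω
  set g : Ω → ℝ := fun ω => M (min (σ ω) N).toNNReal ω
  have hf n : f n =ᵐ[P] P[M N | (hst n).measurableSpace] := by
    refine hM.stoppedValue_ae_eq_condExp_of_le_const_of_countable_range (hst n)
      (fun ω => WithTop.coe_le_coe.2 (discretizedTime_le σ N n ω)) ?_
    rw [Set.range_comp' (fun x : ℝ≥0 => (x : WithTop ℝ≥0))]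
    exact (countable_range_discretizedTime σ N n).image _
  -- All sampled values are conditional expectations of the single variable `M N`, hence uniformly
  -- integrable. Vitali's theorem then turns pointwise convergence into `L¹` convergence.
  have hui : UniformIntegrable f 1 P :=
    ((hM.integrable N).uniformIntegrable_condExp hle).ae_eq fun n => (hf n).symm
  have hfg : ∀ ω, Tendsto (fun n => f n ω) atTop (𝓝 (g ω)) := fun ω =>
    ((hMc ω).tendsto _).comp (tendsto_discretizedTime σ N ω)
  have hg : MemLp g 1 P := hui.memLp_of_ae_tendsto (Eventually.of_forall hfg)
  have hlim := tendsto_Lp_finite_of_tendsto_ae le_rfl ENNReal.one_ne_top hui.1 hg hui.2.1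
    (Eventually.of_forall hfg)
  have hlim' : Tendsto (fun n => ∫ ω in A, f n ω ∂P) atTop (𝓝 (∫ ω in A, g ω ∂P)) :=
    tendsto_setIntegral_of_L1' g hg.1
      (Eventually.of_forall fun n => memLp_one_iff_integrable.1 (hui.memLp n)) hlim A
  have hconst n : ∫ ω in A, f n ω ∂P = ∫ ω in A, M N ω ∂P := by
    rw [setIntegral_congr_ae hA' ((hf n).mono fun ω h _ => h)]
    exact setIntegral_condExp (hle n) (hM.integrable N) (measurableSet_discretizedTime hσ n hA hAN)
  simp only [hconst] at hlim'
  have hgA : Set.EqOn g (fun ω => M (σ ω).toNNReal ω) A := fun ω hω => by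
    have h : σ ω < N := hAN hω
    simp only [g, min_eq_left h.le]
  rw [tendsto_nhds_unique tendsto_const_nhds hlim', setIntegral_congr_fun hA' hgA]
  exact ⟨(memLp_one_iff_integrable.1 hg).integrableOn.congr_fun hgA hA', rfl⟩

end OptionalSampling

/-! ### Brownian martingales in the filtration enlarged by `S`. -/

section EnlargedFiltration

/-- The sets `a ∩ b` form a π-system generating `m₂ ⊔ m₃`, and on them the product formula follows
by splitting off `b` first and then `a`. Here `m₁` will be a Brownian increment, `m₂` the Brownian
past and `m₃` the process `S`. -/
lemma indep_sup_right {P : Measure Ω} [IsProbabilityMeasure P] {m₁ m₂ m₃ : MeasurableSpace Ω}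
    (h₁ : m₁ ≤ mΩ) (h₂ : m₂ ≤ mΩ) (h₃ : m₃ ≤ mΩ) (h₁₂ : Indep m₁ m₂ P)
    (h₁₂₃ : Indep (m₁ ⊔ m₂) m₃ P) : Indep m₁ (m₂ ⊔ m₃) P := by
  have hgen : m₂ ⊔ m₃ = MeasurableSpace.generateFrom
      {s | ∃ a b, MeasurableSet[m₂] a ∧ MeasurableSet[m₃] b ∧ a ∩ b = s} := by
    refine le_antisymm (sup_le (fun a ha => ?_) fun b hb => ?_)
      (MeasurableSpace.generateFrom_le ?_)
    · exact MeasurableSpace.measurableSet_generateFrom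
        ⟨a, Set.univ, ha, MeasurableSet.univ, Set.inter_univ a⟩
    · exact MeasurableSpace.measurableSet_generateFrom
        ⟨Set.univ, b, MeasurableSet.univ, hb, Set.univ_inter b⟩
    · rintro _ ⟨a, b, ha, hb, rfl⟩
      exact MeasurableSet.inter (le_sup_left (a := m₂) (b := m₃) _ ha)
        (le_sup_right (a := m₂) (b := m₃) _ hb)
  refine IndepSets.indep h₁ (sup_le h₂ h₃) (@MeasurableSpace.isPiSystem_measurableSet _ m₁) ?_
    (@MeasurableSpace.generateFrom_measurableSet _ m₁).symm hgen ?_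
  · rintro _ ⟨a, b, ha, hb, rfl⟩ _ ⟨a', b', ha', hb', rfl⟩ -
    exact ⟨a ∩ a', b ∩ b', MeasurableSet.inter ha ha', MeasurableSet.inter hb hb',
      Set.inter_inter_inter_comm _ _ _ _⟩
  · rw [IndepSets_iff]
    rintro s _ hs ⟨a, b, ha, hb, rfl⟩
    rw [Indep_iff] at h₁₂ h₁₂₃
    have hs' : MeasurableSet[m₁ ⊔ m₂] s := le_sup_left (a := m₁) (b := m₂) _ hs
    have ha' : MeasurableSet[m₁ ⊔ m₂] a := le_sup_right (a := m₁) (b := m₂) _ ha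
    rw [← Set.inter_assoc, h₁₂₃ _ _ (MeasurableSet.inter hs' ha') hb, h₁₂ _ _ hs ha,
      h₁₂₃ _ _ ha' hb, mul_assoc]

variable {P : Measure Ω} {B : ℝ≥0 → Ω → ℝ} {S : ℝ≥0 → Ω → ℝ≥0∞}

lemma stronglyAdapted_enlargedFiltration (hB : ∀ t, Measurable (B t))
    (hS : ∀ t, Measurable (S t)) : StronglyAdapted (enlargedFiltration B S hB hS) B := by
  intro t
  refine (Measurable.mono (comap_measurable (B t)) ?_ le_rfl).stronglyMeasurable
  exact le_sup_of_le_left (le_iSup₂_of_le (f := fun y (_ : y ≤ t) =>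
    MeasurableSpace.comap (B y) inferInstance) t le_rfl le_rfl)

lemma measurable_enlargedFiltration (hB : ∀ t, Measurable (B t))
    (hS : ∀ t, Measurable (S t)) (r t : ℝ≥0) :
    Measurable[enlargedFiltration B S hB hS t] (S r) :=
  (comap_measurable (S r)).mono (le_sup_of_le_right
    (le_iSup (fun r => MeasurableSpace.comap (S r) inferInstance) r)) le_rfl

/-- An increment of a Brownian motion independent of `S` is independent of the past of the
Brownian motion together with `S`. -/
lemma indep_increment_enlargedFiltration [IsProbabilityMeasure P]
    (hB : IsBrownianMotion B P) (hS : ∀ t, Measurable (S t))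
    (hind : IndepFun (fun ω t => B t ω) (fun ω t => S t ω) P) {s t : ℝ≥0} (hst : s ≤ t) :
    Indep (MeasurableSpace.comap (fun ω => B t ω - B s ω) inferInstance)
      (enlargedFiltration B S hB.measurable hS s) P := by
  have hBm := hB.measurable
  refine indep_sup_right ((hBm t).sub (hBm s)).comap_le
    (iSup₂_le fun y _ => (hBm y).comap_le) (iSup_le fun r => (hS r).comap_le) ?_ ?_
  · have h := hB.isPreBrownian.indepFun_shift s
    refine indep_of_indep_of_le_left (indep_of_indep_of_le_right h (iSup₂_le fun y hy => ?_)) ?_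
    · refine Measurable.comap_le ?_
      exact (measurable_pi_apply (⟨y, hy⟩ : Set.Iic s)).comp
        (comap_measurable (fun ω (t : Set.Iic s) => B t ω))
    · refine Measurable.comap_le ?_
      have h2 := (measurable_pi_apply (t - s)).comp
        (comap_measurable (fun ω (u : ℝ≥0) => B (s + u) ω - B s ω))
      simpa [Function.comp_def, add_tsub_cancel_of_le hst] using h2
  · have hcoord (y : ℝ≥0) : Measurable[MeasurableSpace.comap (fun ω t => B t ω) inferInstance]
        (B y) := (measurable_pi_apply y).comp (comap_measurable (fun ω t => B t ω))
    refine indep_of_indep_of_le_left (indep_of_indep_of_le_right hind (iSup_le fun r => ?_))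
      (sup_le ?_ (iSup₂_le fun y _ => ?_))
    · refine Measurable.comap_le ?_
      exact (measurable_pi_apply r).comp (comap_measurable (fun ω t => S t ω))
    · exact Measurable.comap_le ((hcoord t).sub (hcoord s))
    · exact (hcoord y).comap_le

/-- A Brownian motion independent of `S` is a martingale in the filtration enlarged by `S`. -/
lemma martingale_brownian [IsProbabilityMeasure P]
    (hB : IsBrownianMotion B P) (hS : ∀ t, Measurable (S t))
    (hind : IndepFun (fun ω t => B t ω) (fun ω t => S t ω) P) :
    Martingale B (enlargedFiltration B S hB.measurable hS) P := by
  have had := stronglyAdapted_enlargedFiltration hB.measurable hS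
  have hint := hB.isPreBrownian.integrable_eval
  refine ⟨had, fun s t hst => ?_⟩
  set 𝓕 := enlargedFiltration B S hB.measurable hS
  have hinc : P[fun ω => B t ω - B s ω | 𝓕 s] =ᵐ[P] fun _ => 0 := by
    refine (condExp_indep_eq ((hB.measurable t).sub (hB.measurable s)).comap_le (𝓕.le s)
      (comap_measurable _).stronglyMeasurable
      (indep_increment_enlargedFiltration hB hS hind hst)).trans ?_
    rw [integral_sub' (hint t) (hint s), hB.isPreBrownian.integral_eval,
      hB.isPreBrownian.integral_eval, sub_zero]
  have h := condExp_sub (hint t) (hint s) (𝓕 s)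
  rw [condExp_of_stronglyMeasurable (𝓕.le s) (had s) (hint s)] at h
  filter_upwards [h, hinc] with ω h1 h2
  have h3 : (0 : ℝ) = P[B t | 𝓕 s] ω - B s ω := by
    rw [← h2]
    exact h1
  linarith

/-- The exponential process `exp (θ B(t) - θ² t / 2)`. -/
noncomputable def exponentialProcess (B : ℝ≥0 → Ω → ℝ) (θ : ℝ) (t : ℝ≥0) (ω : Ω) : ℝ :=
  Real.exp (θ * B t ω - θ ^ 2 / 2 * t)

lemma exponentialProcess_pos (θ : ℝ) (t : ℝ≥0) (ω : Ω) : 0 < exponentialProcess B θ t ω :=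
  Real.exp_pos _

lemma continuous_exponentialProcess (hB : IsBrownianMotion B P) (θ : ℝ) (ω : Ω) :
    Continuous fun t => exponentialProcess B θ t ω := by
  have := hB.continuous_path ω
  unfold exponentialProcess
  fun_prop

/-- Exponential moments of a centered Gaussian variable. -/
lemma integrable_exp_mul_and_integral_eq {X : Ω → ℝ} {v : ℝ≥0} (hX : HasLaw X (gaussianReal 0 v) P)
    (θ : ℝ) : Integrable (fun ω => Real.exp (θ * X ω)) P ∧
      ∫ ω, Real.exp (θ * X ω) ∂P = Real.exp (θ ^ 2 / 2 * v) := by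
  constructor
  · have h := integrable_exp_mul_gaussianReal (μ := 0) (v := v) θ
    rw [← hX.map_eq] at h
    exact h.comp_aemeasurable hX.aemeasurable
  · have h := mgf_gaussianReal hX.map_eq θ
    rw [mgf] at h
    rw [h]
    congr 1
    ring

lemma martingale_exponentialProcess [IsProbabilityMeasure P]
    (hB : IsBrownianMotion B P) (hS : ∀ t, Measurable (S t))
    (hind : IndepFun (fun ω t => B t ω) (fun ω t => S t ω) P) (θ : ℝ) :
    Martingale (exponentialProcess B θ) (enlargedFiltration B S hB.measurable hS) P := by
  set 𝓕 := enlargedFiltration B S hB.measurable hS with h𝓕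
  have hadB : StronglyAdapted 𝓕 B := stronglyAdapted_enlargedFiltration hB.measurable hS
  have hint t : Integrable (exponentialProcess B θ t) P := by
    have h := (integrable_exp_mul_and_integral_eq (hB.isPreBrownian.hasLaw_eval t) θ).1.mul_const
      (Real.exp (-(θ ^ 2 / 2 * t)))
    refine h.congr (Eventually.of_forall fun ω => ?_)
    simp only [exponentialProcess, sub_eq_add_neg, Real.exp_add]
  have had : StronglyAdapted 𝓕 (exponentialProcess B θ) := fun t =>
    (Real.continuous_exp.comp_stronglyMeasurable
      (((hadB t).const_mul θ).sub stronglyMeasurable_const) :)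
  refine ⟨had, fun s t hst => ?_⟩
  -- The multiplicative increment from `s` to `t`: it has mean one and is independent of `𝓕 s`.
  set G : Ω → ℝ := fun ω => Real.exp (θ * (B t ω - B s ω) - θ ^ 2 / 2 * (t - s))
  have hlaw : HasLaw (fun ω => B t ω - B s ω) (gaussianReal 0 (t - s)) P := by
    have h := hB.isPreBrownian.hasLaw_sub t s
    have hd : nndist t.1 s.1 = t - s := by
      apply NNReal.eq
      rw [coe_nndist, Real.dist_eq, NNReal.coe_sub hst]
      exact abs_of_nonneg (sub_nonneg.2 hst)
    rw [hd] at h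
    exact h
  obtain ⟨hi, he⟩ := integrable_exp_mul_and_integral_eq hlaw θ
  have hGeq : G = fun ω => Real.exp (θ * (B t ω - B s ω)) *
      Real.exp (-(θ ^ 2 / 2 * ((t : ℝ) - s))) := by
    ext ω
    simp only [G]
    rw [← Real.exp_add, sub_eq_add_neg]
  have hGint : Integrable G P := by
    rw [hGeq]
    exact hi.mul_const _
  have hG1 : ∫ ω, G ω ∂P = 1 := by
    rw [hGeq, integral_mul_const, he, ← Real.exp_add, NNReal.coe_sub hst, add_neg_cancel,
      Real.exp_zero]
  have hfac : exponentialProcess B θ t = exponentialProcess B θ s * G := by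
    ext ω
    simp only [exponentialProcess, G, Pi.mul_apply]
    rw [← Real.exp_add]
    congr 1
    ring
  have hGc : P[G | 𝓕 s] =ᵐ[P] fun _ => 1 := by
    refine (condExp_indep_eq ((hB.measurable t).sub (hB.measurable s)).comap_le (𝓕.le s)
      ?_ (indep_increment_enlargedFiltration hB hS hind hst)).trans ?_
    · refine Measurable.stronglyMeasurable ?_
      exact (((comap_measurable (fun ω => B t ω - B s ω)).const_mul θ).sub_const _).exp
    · rw [hG1]
  have h := condExp_mul_of_stronglyMeasurable_left (had s) (hfac ▸ hint t) hGint
  rw [hfac]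
  filter_upwards [h, hGc] with ω h1 h2
  rw [h1, Pi.mul_apply, h2, mul_one]

lemma integral_exponentialProcess [IsProbabilityMeasure P] (hB : IsBrownianMotion B P) (θ : ℝ)
    (t : ℝ≥0) : ∫ ω, exponentialProcess B θ t ω ∂P = 1 := by
  simp only [exponentialProcess, sub_eq_add_neg, Real.exp_add]
  rw [integral_mul_const,
    (integrable_exp_mul_and_integral_eq (hB.isPreBrownian.hasLaw_eval t) θ).2, ← Real.exp_add,
    add_neg_cancel, Real.exp_zero]

end EnlargedFiltration

/-! ### Time change by `S`. -/

section TimeChange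

variable {P : Measure Ω} {B : ℝ≥0 → Ω → ℝ} {S : ℝ≥0 → Ω → ℝ≥0∞}

/-- The whole process `S` is measurable with respect to each `𝓕_{S(t)}`. -/
lemma measurable_stoppingTime_baseFiltration (hB : ∀ t, Measurable (B t))
    (hS : ∀ t, Measurable (S t)) (r t : ℝ≥0) :
    Measurable[(isStoppingTime_baseFiltration B S hB hS t).measurableSpace] (S r) := by
  intro E hE
  have h i : MeasurableSet[baseFiltration B S hB hS i] (S r ⁻¹' E) :=
    (enlargedFiltration B S hB hS).le_rightCont i _ (measurable_enlargedFiltration hB hS r i hE)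
  exact ⟨le_iSup (baseFiltration B S hB hS) 0 _ (h 0), fun i =>
    (h i).inter (isStoppingTime_baseFiltration B S hB hS t i)⟩

/-- A continuous process adapted to the enlarged filtration, evaluated at time `S(t)`, is
measurable with respect to `𝓕_{S(t)}`. -/
lemma stronglyMeasurable_eval_toNNReal (hB : ∀ t, Measurable (B t)) (hS : ∀ t, Measurable (S t))
    {M : ℝ≥0 → Ω → ℝ} (hM : StronglyAdapted (enlargedFiltration B S hB hS) M)
    (hMc : ∀ ω, Continuous fun t => M t ω) (t : ℝ≥0) :
    StronglyMeasurable[(isStoppingTime_baseFiltration B S hB hS t).measurableSpace]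
      (fun ω => M (S t ω).toNNReal ω) := by
  have hst := isStoppingTime_baseFiltration B S hB hS t
  have hM' : StronglyAdapted (baseFiltration B S hB hS) M := fun i =>
    (hM i).mono ((enlargedFiltration B S hB hS).le_rightCont i)
  have hprog := hM'.isStronglyProgressive_of_continuous hMc
  have h0 : baseFiltration B S hB hS 0 ≤ hst.measurableSpace := by
    rw [← IsStoppingTime.measurableSpace_const (baseFiltration B S hB hS) 0]
    exact IsStoppingTime.measurableSpace_mono _ _ fun ω => bot_le
  have htop : MeasurableSet[hst.measurableSpace] {ω | S t ω = ⊤} :=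
    measurable_stoppingTime_baseFiltration hB hS t t (measurableSet_singleton ⊤)
  -- On `{S t = ⊤}` the convention `toNNReal ⊤ = 0` selects `M 0`, which `stoppedValue` need not do,
  -- so that event is treated separately.
  classical
  have heq : (fun ω => M (S t ω).toNNReal ω) =
      {ω | S t ω = ⊤}.piecewise (M 0) (stoppedValue M (S t)) := by
    ext ω
    by_cases h : S t ω = ⊤
    · rw [Set.piecewise_eq_of_mem {ω | S t ω = ⊤} _ _ h, h, ENNReal.toNNReal_top]
    · rw [Set.piecewise_eq_of_notMem {ω | S t ω = ⊤} _ _ h]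
      change M _ ω = M (WithTop.untopA (S t ω)) ω
      congr 1
      change S t ω ≠ ⊤ at h
      generalize S t ω = x at h ⊢
      lift x to ℝ≥0 using h
      rw [ENNReal.toNNReal_coe]
      exact (WithTop.untopD_coe _ x).symm
  rw [heq]
  refine Measurable.stronglyMeasurable ?_
  exact Measurable.piecewise htop ((hM' 0).mono h0).measurable
    (measurable_stoppedValue hprog hst)

lemma measurableSet_inter_lt_stoppingTime (hB : ∀ t, Measurable (B t))
    (hS : ∀ t, Measurable (S t)) {s : ℝ≥0} (t : ℝ≥0) {A : Set Ω}
    (hA : MeasurableSet[(isStoppingTime_baseFiltration B S hB hS s).measurableSpace] A) (N : ℝ≥0) :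
    MeasurableSet[(isStoppingTime_baseFiltration B S hB hS s).measurableSpace]
      (A ∩ {ω | S t ω < N}) :=
  MeasurableSet.inter hA (measurable_stoppingTime_baseFiltration hB hS t s measurableSet_Iio)

lemma iUnion_inter_lt_nat_ae_eq {t : ℝ≥0} (hfin : ∀ᵐ ω ∂P, S t ω ≠ ⊤) (A : Set Ω) :
    (⋃ n : ℕ, A ∩ {ω | S t ω < ((n : ℝ≥0) : ℝ≥0∞)}) =ᵐ[P] A := by
  filter_upwards [hfin] with ω hω
  refine propext ⟨fun h => ?_, fun h => ?_⟩
  · obtain ⟨n, hn⟩ := Set.mem_iUnion.1 h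
    exact hn.1
  · obtain ⟨n, hn⟩ := ENNReal.exists_nat_gt hω
    exact Set.mem_iUnion.2 ⟨n, h, by simpa using hn⟩

lemma monotone_inter_lt_nat (t : ℝ≥0) (A : Set Ω) :
    Monotone fun n : ℕ => A ∩ {ω | S t ω < ((n : ℝ≥0) : ℝ≥0∞)} := by
  intro m n hmn ω hω
  have h : ((m : ℝ≥0) : ℝ≥0∞) ≤ ((n : ℝ≥0) : ℝ≥0∞) := by exact_mod_cast hmn
  have hlt : S t ω < ((m : ℝ≥0) : ℝ≥0∞) := hω.2
  exact ⟨hω.1, hlt.trans_le h⟩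

/-- Time change of a continuous martingale of the enlarged filtration. -/
lemma setIntegral_eval_toNNReal_eq [IsProbabilityMeasure P]
    (hB : ∀ t, Measurable (B t)) (hS : ∀ t, Measurable (S t))
    {M : ℝ≥0 → Ω → ℝ} (hM : Martingale M (enlargedFiltration B S hB hS) P)
    (hMc : ∀ ω, Continuous fun t => M t ω) {s t : ℝ≥0} (hst : ∀ ω, S s ω ≤ S t ω)
    (hfin : ∀ᵐ ω ∂P, S t ω ≠ ⊤)
    (hints : Integrable (fun ω => M (S s ω).toNNReal ω) P)
    (hintt : Integrable (fun ω => M (S t ω).toNNReal ω) P) {A : Set Ω}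
    (hA : MeasurableSet[(isStoppingTime_baseFiltration B S hB hS s).measurableSpace] A) :
    ∫ ω in A, M (S t ω).toNNReal ω ∂P = ∫ ω in A, M (S s ω).toNNReal ω ∂P := by
  have hσ := isStoppingTime_baseFiltration B S hB hS
  have hAt : MeasurableSet[(hσ t).measurableSpace] A :=
    IsStoppingTime.measurableSpace_mono (hσ s) (hσ t) hst _ hA
  have hmeas (n : ℕ) : MeasurableSet (A ∩ {ω | S t ω < ((n : ℝ≥0) : ℝ≥0∞)}) :=
    (hσ t).measurableSpace_le _ (measurableSet_inter_lt_stoppingTime hB hS t hAt n)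
  -- On `{S t < n}` also `S s < n`, so both sides equal the integral of `M n`. The event is
  -- admissible at both times because `S t` is already known at time `S s`.
  have heq (n : ℕ) : ∫ ω in A ∩ {ω | S t ω < ((n : ℝ≥0) : ℝ≥0∞)}, M (S t ω).toNNReal ω ∂P =
      ∫ ω in A ∩ {ω | S t ω < ((n : ℝ≥0) : ℝ≥0∞)}, M (S s ω).toNNReal ω ∂P := by
    rw [(integrableOn_and_setIntegral_eval_toNNReal_eq hM hMc (hσ t)
        (measurableSet_inter_lt_stoppingTime hB hS t hAt n) Set.inter_subset_right).2,
      (integrableOn_and_setIntegral_eval_toNNReal_eq hM hMc (hσ s)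
        (measurableSet_inter_lt_stoppingTime hB hS t hA n)
        fun ω hω => (hst ω).trans_lt hω.2).2]
  have hU := iUnion_inter_lt_nat_ae_eq hfin A
  have h1 := tendsto_setIntegral_of_monotone hmeas (monotone_inter_lt_nat t A)
    hintt.integrableOn
  have h2 := tendsto_setIntegral_of_monotone hmeas (monotone_inter_lt_nat t A)
    hints.integrableOn
  rw [setIntegral_congr_set hU] at h1 h2
  simp only [heq] at h1
  exact tendsto_nhds_unique h1 h2

/-- The time-changed exponential process is integrable. -/
lemma integrable_exponentialProcess_eval [IsProbabilityMeasure P] (hB : IsBrownianMotion B P)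
    (hS : ∀ t, Measurable (S t))
    (hind : IndepFun (fun ω t => B t ω) (fun ω t => S t ω) P) (θ : ℝ) {t : ℝ≥0}
    (hfin : ∀ᵐ ω ∂P, S t ω ≠ ⊤) :
    Integrable (fun ω => exponentialProcess B θ (S t ω).toNNReal ω) P := by
  have hM := martingale_exponentialProcess hB hS hind θ
  have hMc := continuous_exponentialProcess hB θ
  have hσ := isStoppingTime_baseFiltration B S hB.measurable hS t
  refine ⟨((stronglyMeasurable_eval_toNNReal hB.measurable hS hM.stronglyAdapted hMc t).mono
    hσ.measurableSpace_le).aestronglyMeasurable, ?_⟩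
  rw [hasFiniteIntegral_iff_ofReal
    (Eventually.of_forall fun ω => (exponentialProcess_pos _ _ _).le)]
  refine lt_of_le_of_lt ?_ ENNReal.one_lt_top
  have hU := iUnion_inter_lt_nat_ae_eq hfin Set.univ
  rw [← setLIntegral_univ, ← setLIntegral_congr hU,
    setLIntegral_iUnion_of_directed _ (monotone_inter_lt_nat t _).directed_le]
  refine iSup_le fun n => ?_
  have hmeas := measurableSet_inter_lt_stoppingTime hB.measurable hS t
    (A := Set.univ) (s := t) MeasurableSet.univ n
  obtain ⟨hi, he⟩ := integrableOn_and_setIntegral_eval_toNNReal_eq hM hMc hσ hmeas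
    Set.inter_subset_right
  rw [← ofReal_integral_eq_lintegral_ofReal hi
    (Eventually.of_forall fun ω => (exponentialProcess_pos _ _ _).le), he,
    ENNReal.ofReal_le_one, ← integral_exponentialProcess hB θ (n : ℝ≥0)]
  exact setIntegral_le_integral (hM.integrable _)
    (Eventually.of_forall fun ω => (exponentialProcess_pos _ _ _).le)

end TimeChange

/-! ### Finiteness and exponential moments of the inverse subordinator. -/

section FirstPassage

lemma laplaceExponent_one_pos {ν : Measure ℝ} (hν : IsSubordinatorLevyMeasure ν)
    (hν_ne : ν (Set.Ioi 0) ≠ 0) : 0 < laplaceExponent ν 1 := by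
  have hnn : ∀ᵐ x ∂ν.restrict (Set.Ioi 0), 0 ≤ 1 - Real.exp (-(1 * x)) := by
    refine (ae_restrict_iff' measurableSet_Ioi).2 (Eventually.of_forall fun x hx => ?_)
    have : (0 : ℝ) < x := hx
    rw [sub_nonneg, Real.exp_le_one_iff]
    linarith
  have hle : ∀ᵐ x ∂ν.restrict (Set.Ioi 0), 1 - Real.exp (-(1 * x)) ≤ min 1 x := by
    refine Eventually.of_forall fun x => le_min ?_ ?_
    · linarith [Real.exp_pos (-(1 * x))]
    · linarith [Real.add_one_le_exp (-(1 * x))]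
  have hint : IntegrableOn (fun x => 1 - Real.exp (-(1 * x))) (Set.Ioi 0) ν := by
    refine ⟨(Measurable.aestronglyMeasurable (by fun_prop)), ?_⟩
    rw [hasFiniteIntegral_iff_ofReal hnn]
    exact (lintegral_mono_ae (hle.mono fun x h => ENNReal.ofReal_le_ofReal h)).trans_lt
      hν.lintegral_min_lt_top
  rw [laplaceExponent, setIntegral_pos_iff_support_of_nonneg_ae hnn hint]
  refine pos_iff_ne_zero.2 fun h => hν_ne (measure_mono_null ?_ h)
  intro x hx
  refine ⟨?_, hx⟩
  have hx' : (0 : ℝ) < x := hx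
  have : Real.exp (-(1 * x)) < 1 := Real.exp_lt_one_iff.2 (by linarith)
  exact (sub_pos.2 this).ne'

variable {P : Measure Ω} [IsProbabilityMeasure P] {T : ℝ≥0 → Ω → ℝ} {f : ℝ → ℝ}

/-- The Chernoff bound for the tail of the first-passage time. -/
lemma measure_lt_firstPassage_le (hf : HasLaplaceExponent T f P) (t : ℝ≥0) {n : ℝ≥0} (hn : 0 < n) :
    P {ω | (n : ℝ≥0∞) < firstPassage T t ω} ≤ ENNReal.ofReal (Real.exp (t - n * f 1)) := by
  have hsub : {ω | (n : ℝ≥0∞) < firstPassage T t ω} ⊆ {ω | T n ω ≤ t} := by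
    intro ω (hω : (n : ℝ≥0∞) < firstPassage T t ω)
    refine (not_lt.1 fun h => hω.not_ge ?_ : T n ω ≤ t)
    exact iInf₂_le n ⟨hn, h⟩
  have he := hf n 1 zero_le_one
  -- A non-integrable function would have Bochner integral `0`, contradicting the positive Laplace
  -- transform.
  have hint : Integrable (fun ω => Real.exp (-1 * T n ω)) P := by
    by_contra h
    have h0 := integral_undef h
    simp only [neg_mul, one_mul] at h0 he
    exact (Real.exp_pos _).ne' (he.symm.trans h0)
  have hch := measure_le_le_exp_mul_mgf (μ := P) (X := T n) (t : ℝ)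
    (by norm_num : (-1 : ℝ) ≤ 0) hint
  have hmgf : mgf (T n) P (-1) = Real.exp (-(n * f 1)) := by
    rw [← he, mgf]
    simp only [neg_mul]
  refine (measure_mono hsub).trans ?_
  rw [← ofReal_measureReal]
  refine ENNReal.ofReal_le_ofReal (hch.trans_eq ?_)
  rw [hmgf, ← Real.exp_add]
  congr 1
  ring

lemma firstPassage_ne_top_ae (hf : HasLaplaceExponent T f P) (hf1 : 0 < f 1) (t : ℝ≥0) :
    ∀ᵐ ω ∂P, firstPassage T t ω ≠ ⊤ := by
  rw [ae_iff]
  simp only [not_not]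
  have hlim : Tendsto (fun n : ℕ => ENNReal.ofReal (Real.exp (t - ((n + 1 : ℕ) : ℝ) * f 1))) atTop
      (𝓝 0) := by
    rw [← ENNReal.ofReal_zero]
    refine ENNReal.tendsto_ofReal (Real.tendsto_exp_atBot.comp ?_)
    refine tendsto_atBot_add_const_left _ _ (tendsto_neg_atTop_atBot.comp ?_)
    exact (tendsto_natCast_atTop_atTop.comp (tendsto_add_atTop_nat 1)).atTop_mul_const hf1
  refine le_antisymm (ge_of_tendsto' hlim fun n => ?_) zero_le
  refine le_trans (measure_mono fun ω hω => ?_)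
    (measure_lt_firstPassage_le (n := ((n + 1 : ℕ) : ℝ≥0)) hf t (by positivity))
  have h : firstPassage T t ω = ⊤ := hω
  simp [h]

/-- The inverse subordinator has a finite exponential moment. -/
lemma integrable_exp_inverseSubordinator (hm : ∀ t, Measurable (firstPassage T t))
    (hf : HasLaplaceExponent T f P) (hf1 : 0 < f 1) (t : ℝ≥0) :
    Integrable (fun ω => Real.exp (f 1 / 2 * (inverseSubordinator T t ω : ℝ))) P := by
  -- Half the Chernoff rate, so that the series below is geometric with ratio `exp (-c)`.
  set c := f 1 / 2 with hc
  have hc0 : 0 < c := by positivity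
  refine ⟨Measurable.aestronglyMeasurable ?_, ?_⟩
  · have := (hm t).ennreal_toNNReal
    unfold inverseSubordinator
    fun_prop
  rw [hasFiniteIntegral_iff_ofReal (Eventually.of_forall fun ω => (Real.exp_pos _).le)]
  -- `E 0` is the whole space, so the series has a usable term even where the inverse is `0`.
  set E : ℕ → Set Ω := fun n => {ω | n = 0 ∨ ((n : ℝ≥0) : ℝ≥0∞) < firstPassage T t ω}
  have hE n : MeasurableSet (E n) :=
    (MeasurableSet.const _).union (measurableSet_lt measurable_const (hm t))
  have hPE (n : ℕ) : P (E n) ≤ ENNReal.ofReal (Real.exp (t - n * f 1)) := by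
    rcases Nat.eq_zero_or_pos n with rfl | hn
    · refine prob_le_one.trans ?_
      rw [ENNReal.one_le_ofReal]
      simp
    · have hn' : (0 : ℝ≥0) < n := by exact_mod_cast hn
      have h : E n = {ω | ((n : ℝ≥0) : ℝ≥0∞) < firstPassage T t ω} := by
        ext ω
        simp [E, hn.ne']
      rw [h]
      simpa using measure_lt_firstPassage_le hf t hn'
  have hpt : ∀ ω, ENNReal.ofReal (Real.exp (c * (inverseSubordinator T t ω : ℝ))) ≤
      ∑' n : ℕ, (E n).indicator (fun _ => ENNReal.ofReal (Real.exp (c * (n + 1)))) ω := by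
    intro ω
    set x := inverseSubordinator T t ω with hx
    set k := ⌈x⌉₊ - 1
    have hk : ω ∈ E k := by
      rcases Nat.eq_zero_or_pos k with hk | hk
      · exact Or.inl hk
      · refine Or.inr ?_
        have h1 : (k : ℝ≥0) < x := Nat.lt_ceil.1 (by omega)
        exact (ENNReal.coe_lt_coe.2 h1).trans_le ENNReal.coe_toNNReal_le_self
    refine le_trans ?_ (ENNReal.le_tsum k)
    rw [Set.indicator_of_mem hk]
    refine ENNReal.ofReal_le_ofReal (Real.exp_le_exp.2 (mul_le_mul_of_nonneg_left ?_ hc0.le))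
    have h2 : x ≤ ((k + 1 : ℕ) : ℝ≥0) := (Nat.le_ceil x).trans (by
      exact_mod_cast (by omega : ⌈x⌉₊ ≤ k + 1))
    exact_mod_cast h2
  have hterm (n : ℕ) : ENNReal.ofReal (Real.exp (c * (n + 1))) * P (E n) ≤
      ENNReal.ofReal (Real.exp (c + t) * Real.exp (-c) ^ n) := by
    refine (mul_le_mul_right (hPE n) _).trans_eq ?_
    rw [← ENNReal.ofReal_mul (Real.exp_pos _).le, ← Real.exp_add, ← Real.exp_nat_mul,
      ← Real.exp_add]
    congr 2
    have : f 1 = 2 * c := by rw [hc]; ring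
    rw [this]
    ring
  have hsum : Summable fun n : ℕ => Real.exp (c + t) * Real.exp (-c) ^ n :=
    (summable_geometric_of_lt_one (Real.exp_pos _).le
      (Real.exp_lt_one_iff.2 (neg_lt_zero.2 hc0))).mul_left _
  calc ∫⁻ ω, ENNReal.ofReal (Real.exp (c * (inverseSubordinator T t ω : ℝ))) ∂P
      ≤ ∫⁻ ω, ∑' n : ℕ, (E n).indicator (fun _ => ENNReal.ofReal (Real.exp (c * (n + 1)))) ω ∂P :=
        lintegral_mono hpt
    _ = ∑' n : ℕ, ENNReal.ofReal (Real.exp (c * (n + 1))) * P (E n) := by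
        rw [lintegral_tsum fun n => (measurable_const.indicator (hE n)).aemeasurable]
        exact tsum_congr fun n => lintegral_indicator_const (hE n) _
    _ ≤ ∑' n : ℕ, ENNReal.ofReal (Real.exp (c + t) * Real.exp (-c) ^ n) :=
        ENNReal.tsum_le_tsum hterm
    _ < ⊤ := by
        rw [← ENNReal.ofReal_tsum_of_nonneg (fun n => by positivity) hsum]
        exact ENNReal.ofReal_lt_top

end FirstPassage

/-! ### The martingales of part (i) and the change of measure. -/

section Martingales

variable {P : Measure Ω}

lemma martingale_of_setIntegral_eq {ι : Type*} [Preorder ι] [IsFiniteMeasure P]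
    {𝓕 : Filtration ι mΩ} {M : ι → Ω → ℝ} (had : StronglyAdapted 𝓕 M)
    (hint : ∀ i, Integrable (M i) P)
    (heq : ∀ i j, i ≤ j → ∀ A, MeasurableSet[𝓕 i] A → ∫ ω in A, M j ω ∂P = ∫ ω in A, M i ω ∂P) :
    Martingale M 𝓕 P :=
  ⟨had, fun i j hij => (ae_eq_condExp_of_forall_setIntegral_eq (𝓕.le i) (hint j)
    (fun _ _ _ => (hint i).integrableOn) (fun A hA _ => (heq i j hij A hA).symm)
    (had i).aestronglyMeasurable).symm⟩

/-- If two nonnegative densities have the same integrals over the events of a sub-σ-algebra, then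
they weight every nonnegative function measurable for that σ-algebra equally. -/
lemma lintegral_mul_ofReal_eq {m mΩ : MeasurableSpace Ω} {P : Measure Ω} (hm : m ≤ mΩ) {U V : Ω → ℝ}
    (hU : Integrable U P) (hV : Integrable V P) (hU0 : ∀ ω, 0 ≤ U ω) (hV0 : ∀ ω, 0 ≤ V ω)
    (heq : ∀ A, MeasurableSet[m] A → ∫ ω in A, U ω ∂P = ∫ ω in A, V ω ∂P)
    {Y : Ω → ℝ≥0∞} (hY : Measurable[m] Y) :
    ∫⁻ ω, ENNReal.ofReal (U ω) * Y ω ∂P = ∫⁻ ω, ENNReal.ofReal (V ω) * Y ω ∂P := by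
  -- The hypothesis says that the two weighted measures coincide on `m`.
  have htrim : (P.withDensity fun ω => ENNReal.ofReal (U ω)).trim hm =
      (P.withDensity fun ω => ENNReal.ofReal (V ω)).trim hm := by
    refine @Measure.ext _ m _ _ fun A hA => ?_
    rw [trim_measurableSet_eq hm hA, trim_measurableSet_eq hm hA, withDensity_apply _ (hm _ hA),
      withDensity_apply _ (hm _ hA), ← ofReal_integral_eq_lintegral_ofReal hU.integrableOn
        (Eventually.of_forall hU0), ← ofReal_integral_eq_lintegral_ofReal hV.integrableOn
        (Eventually.of_forall hV0), heq A hA]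
  have hY' : Measurable Y := hY.mono hm le_rfl
  have h := lintegral_trim (μ := P.withDensity fun ω => ENNReal.ofReal (U ω)) hm hY
  rw [htrim, lintegral_trim hm hY,
    lintegral_withDensity_eq_lintegral_mul₀ hU.1.aemeasurable.ennreal_ofReal hY'.aemeasurable,
    lintegral_withDensity_eq_lintegral_mul₀ hV.1.aemeasurable.ennreal_ofReal hY'.aemeasurable] at h
  exact h.symm

variable {B T : ℝ≥0 → Ω → ℝ}

/-- The value of the exponential process at the inverse subordinator. -/
noncomputable def timeChangedExponential (B T : ℝ≥0 → Ω → ℝ) (θ : ℝ) (t : ℝ≥0) (ω : Ω) : ℝ :=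
  exponentialProcess B θ (inverseSubordinator T t ω) ω

lemma timeChangedExponential_eq (θ : ℝ) (t : ℝ≥0) (ω : Ω) :
    timeChangedExponential B T θ t ω =
      Real.exp (θ * subdiffusion B T t ω - θ ^ 2 / 2 * (inverseSubordinator T t ω : ℝ)) := rfl

lemma timeChangedExponential_pos (θ : ℝ) (t : ℝ≥0) (ω : Ω) :
    0 < timeChangedExponential B T θ t ω := Real.exp_pos _

lemma exp_tilt_eq (a : ℝ≥0) (ε : ℝ) (ω : Ω) :
    Real.exp (-(1 / 2) * subdiffusion B T a ω - (ε + 1 / 8) * (inverseSubordinator T a ω : ℝ)) =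
      timeChangedExponential B T (-(1 / 2)) a ω *
        Real.exp (-(ε * (inverseSubordinator T a ω : ℝ))) := by
  rw [timeChangedExponential_eq, ← Real.exp_add]
  congr 1
  ring

lemma stronglyAdapted_subdiffusion (hB : IsBrownianMotion B P)
    (hT : IsSubordinator T P) :
    StronglyAdapted (timeChangedFiltration hB hT) (subdiffusion B T) := fun t =>
  stronglyMeasurable_eval_toNNReal hB.measurable
    (measurable_firstPassage hT.measurable hT.right_continuous)
    (stronglyAdapted_enlargedFiltration _ _) hB.continuous_path t

lemma measurable_inverseSubordinator (hB : IsBrownianMotion B P)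
    (hT : IsSubordinator T P) (r t : ℝ≥0) :
    Measurable[timeChangedFiltration hB hT t] (inverseSubordinator T r) :=
  (measurable_stoppingTime_baseFiltration hB.measurable
    (measurable_firstPassage hT.measurable hT.right_continuous) r t).ennreal_toNNReal

lemma measurable_exp_neg_mul_inverseSubordinator (hB : IsBrownianMotion B P)
    (hT : IsSubordinator T P) (a t : ℝ≥0) (ε : ℝ) :
    Measurable[timeChangedFiltration hB hT t]
      (fun ω => Real.exp (-(ε * (inverseSubordinator T a ω : ℝ)))) :=
  (((measurable_inverseSubordinator hB hT a t).coe_nnreal_real).const_mul ε).neg.exp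

lemma martingale_timeChangedExponential [IsProbabilityMeasure P] (hB : IsBrownianMotion B P)
    (hT : IsSubordinator T P)
    (hind : IndepFun (fun ω t => B t ω) (fun ω t => firstPassage T t ω) P)
    (hfin : ∀ t, ∀ᵐ ω ∂P, firstPassage T t ω ≠ ⊤)
    (θ : ℝ) :
    Martingale (timeChangedExponential B T θ) (timeChangedFiltration hB hT) P := by
  have hS := measurable_firstPassage hT.measurable hT.right_continuous
  have hM := martingale_exponentialProcess hB hS hind θ
  have hMc := continuous_exponentialProcess hB θ
  have hint t := integrable_exponentialProcess_eval hB hS hind θ (hfin t)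
  exact martingale_of_setIntegral_eq
    (fun t => stronglyMeasurable_eval_toNNReal hB.measurable hS hM.stronglyAdapted hMc t) hint
    fun s t hst A hA => setIntegral_eval_toNNReal_eq hB.measurable hS hM hMc
      (firstPassage_mono T hst) (hfin t) (hint s) (hint t) hA

/-- `|X(t)|` is dominated by exponentials `exp (± θ X(t))`, each the product of an exponential
martingale and a factor `exp (θ² S(t))`. The inequality `uv ≤ u² + v²` separates the two. -/
lemma integrable_subdiffusion [IsProbabilityMeasure P] (hB : IsBrownianMotion B P)
    (hT : IsSubordinator T P)
    (hind : IndepFun (fun ω t => B t ω) (fun ω t => firstPassage T t ω) P)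
    (hfin : ∀ t, ∀ᵐ ω ∂P, firstPassage T t ω ≠ ⊤)
    {f : ℝ → ℝ} (hf : HasLaplaceExponent T f P) (hf1 : 0 < f 1)
    (t : ℝ≥0) : Integrable (subdiffusion B T t) P := by
  have hS := measurable_firstPassage hT.measurable hT.right_continuous
  have hexp θ := (martingale_timeChangedExponential hB hT hind hfin θ).integrable t
  have hmom := integrable_exp_inverseSubordinator hS hf hf1 t
  -- Chosen so that `exp (θ² S(t))` squared is `exp (f(1) S(t) / 2)`, the moment known to be finite.
  set θ := Real.sqrt (f 1 / 4)
  have hθ : 0 < θ := Real.sqrt_pos.2 (by positivity)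
  have hθ2 : θ ^ 2 = f 1 / 4 := Real.sq_sqrt (by positivity)
  refine ((((hexp (2 * θ)).add (hexp (-(2 * θ)))).add (hmom.const_mul 2)).const_mul θ⁻¹).mono'
    ((stronglyAdapted_subdiffusion hB hT t).mono
      ((timeChangedFiltration hB hT).le t)).aestronglyMeasurable (Eventually.of_forall fun ω => ?_)
  simp only [Pi.add_apply, timeChangedExponential_eq]
  set b := subdiffusion B T t ω
  set x : ℝ := (inverseSubordinator T t ω : ℝ)
  have key (y : ℝ) : Real.exp (θ * y) ≤
      Real.exp (2 * θ * y - (2 * θ) ^ 2 / 2 * x) + Real.exp (f 1 / 2 * x) := by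
    have h1 : Real.exp (2 * θ * y - (2 * θ) ^ 2 / 2 * x) = Real.exp (θ * y - θ ^ 2 * x) ^ 2 := by
      rw [← Real.exp_nat_mul]
      congr 1
      push_cast
      ring
    have h2 : Real.exp (f 1 / 2 * x) = Real.exp (θ ^ 2 * x) ^ 2 := by
      rw [← Real.exp_nat_mul, hθ2]
      congr 1
      push_cast
      ring
    have h3 : Real.exp (θ * y) = Real.exp (θ * y - θ ^ 2 * x) * Real.exp (θ ^ 2 * x) := by
      rw [← Real.exp_add, sub_add_cancel]
    rw [h1, h2, h3]
    nlinarith [sq_nonneg (Real.exp (θ * y - θ ^ 2 * x) - Real.exp (θ ^ 2 * x)),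
      sq_nonneg (Real.exp (θ * y - θ ^ 2 * x)), sq_nonneg (Real.exp (θ ^ 2 * x))]
  have habs : θ * |b| ≤ Real.exp (θ * b) + Real.exp (θ * -b) := by
    have h1 := Real.add_one_le_exp (θ * b)
    have h2 := Real.add_one_le_exp (θ * -b)
    have h3 := Real.exp_pos (θ * b)
    have h4 := Real.exp_pos (θ * -b)
    rcases abs_cases b with ⟨h, -⟩ | ⟨h, -⟩ <;> rw [h] <;> linarith
  have hk1 := key b
  have hk2 := key (-b)
  rw [show 2 * θ * -b = -(2 * θ) * b by ring] at hk2
  rw [Real.norm_eq_abs, ← div_eq_inv_mul, le_div_iff₀ hθ, neg_sq, mul_comm]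
  linarith

lemma martingale_subdiffusion [IsProbabilityMeasure P] (hB : IsBrownianMotion B P)
    (hT : IsSubordinator T P)
    (hind : IndepFun (fun ω t => B t ω) (fun ω t => firstPassage T t ω) P)
    (hfin : ∀ t, ∀ᵐ ω ∂P, firstPassage T t ω ≠ ⊤)
    {f : ℝ → ℝ} (hf : HasLaplaceExponent T f P) (hf1 : 0 < f 1) :
    Martingale (subdiffusion B T) (timeChangedFiltration hB hT) P := by
  have hS := measurable_firstPassage hT.measurable hT.right_continuous
  have hint := integrable_subdiffusion hB hT hind hfin hf hf1
  exact martingale_of_setIntegral_eq (stronglyAdapted_subdiffusion hB hT) hint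
    fun s t hst A hA => setIntegral_eval_toNNReal_eq hB.measurable hS
      (martingale_brownian hB hS hind) hB.continuous_path
      (firstPassage_mono T hst) (hfin t) (hint s) (hint t) hA

lemma integrable_timeChangedExponential_mul [IsProbabilityMeasure P] (hB : IsBrownianMotion B P)
    (hT : IsSubordinator T P)
    (hind : IndepFun (fun ω t => B t ω) (fun ω t => firstPassage T t ω) P)
    (hfin : ∀ t, ∀ᵐ ω ∂P, firstPassage T t ω ≠ ⊤)
    (θ : ℝ) (a : ℝ≥0) {ε : ℝ} (hε : 0 ≤ ε) :
    Integrable (fun ω => timeChangedExponential B T θ a ω *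
      Real.exp (-(ε * (inverseSubordinator T a ω : ℝ)))) P := by
  refine ((martingale_timeChangedExponential hB hT hind hfin θ).integrable a).mul_bdd (c := 1)
    ((measurable_exp_neg_mul_inverseSubordinator hB hT a a ε).mono
      ((timeChangedFiltration hB hT).le a) le_rfl).aestronglyMeasurable
    (Eventually.of_forall fun ω => ?_)
  rw [Real.norm_eq_abs, Real.abs_exp, Real.exp_le_one_iff, neg_nonpos]
  positivity

/-- Weighting `exp (X(t))` by the tilting density gives the same mass to an event of `𝓖_t` as
the weight at the final time. -/
lemma setLIntegral_tilt_mul_exp_eq [IsProbabilityMeasure P] (hB : IsBrownianMotion B P)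
    (hT : IsSubordinator T P)
    (hind : IndepFun (fun ω t => B t ω) (fun ω t => firstPassage T t ω) P)
    (hfin : ∀ t, ∀ᵐ ω ∂P, firstPassage T t ω ≠ ⊤)
    {a t : ℝ≥0} (hta : t ≤ a) (ε : ℝ) {A : Set Ω}
    (hA : MeasurableSet[timeChangedFiltration hB hT t] A) :
    ∫⁻ ω in A, ENNReal.ofReal (Real.exp (-(1 / 2) * subdiffusion B T a ω -
        (ε + 1 / 8) * (inverseSubordinator T a ω : ℝ)) * Real.exp (subdiffusion B T t ω)) ∂P =
      ∫⁻ ω in A, ENNReal.ofReal (timeChangedExponential B T (1 / 2) a ω *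
        Real.exp (-(ε * (inverseSubordinator T a ω : ℝ)))) ∂P := by
  set 𝓖 := timeChangedFiltration hB hT
  have hA' : MeasurableSet A := 𝓖.le t _ hA
  have hM θ := martingale_timeChangedExponential hB hT hind hfin θ
  have hpos θ (s : ℝ≥0) (ω : Ω) := (timeChangedExponential_pos (B := B) (T := T) θ s ω).le
  -- Lower integrals allow the exchange of times before the weighted products are known to be
  -- integrable.
  have hswap θ {Y : Ω → ℝ≥0∞} (hY : Measurable[𝓖 t] Y) :=
    lintegral_mul_ofReal_eq (𝓖.le t) ((hM θ).integrable a) ((hM θ).integrable t) (hpos θ a)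
      (hpos θ t) (fun A hA => ((hM θ).setIntegral_eq hta hA).symm) hY
  have hE := measurable_exp_neg_mul_inverseSubordinator hB hT a t ε
  have hX : Measurable[𝓖 t] fun ω => Real.exp (subdiffusion B T t ω) :=
    (stronglyAdapted_subdiffusion hB hT t).measurable.exp
  rw [← lintegral_indicator hA', ← lintegral_indicator hA']
  calc _ = ∫⁻ ω, ENNReal.ofReal (timeChangedExponential B T (-(1 / 2)) a ω) *
        A.indicator (fun ω => ENNReal.ofReal (Real.exp (subdiffusion B T t ω) *
          Real.exp (-(ε * (inverseSubordinator T a ω : ℝ))))) ω ∂P := by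
        refine lintegral_congr fun ω => ?_
        by_cases hω : ω ∈ A
        · simp only [Set.indicator_of_mem hω]
          rw [exp_tilt_eq, ← ENNReal.ofReal_mul (hpos _ _ _)]
          congr 1
          ring
        · simp [Set.indicator_of_notMem hω]
    _ = ∫⁻ ω, ENNReal.ofReal (timeChangedExponential B T (-(1 / 2)) t ω) *
        A.indicator (fun ω => ENNReal.ofReal (Real.exp (subdiffusion B T t ω) *
          Real.exp (-(ε * (inverseSubordinator T a ω : ℝ))))) ω ∂P :=
        hswap _ ((hX.mul hE).ennreal_ofReal.indicator hA)
    -- Multiplying by `exp (X(t))` moves `θ` from `-1/2` to `1/2` and keeps the compensator, since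
    -- `θ²` is unchanged.
    _ = ∫⁻ ω, ENNReal.ofReal (timeChangedExponential B T (1 / 2) t ω) *
        A.indicator (fun ω => ENNReal.ofReal
          (Real.exp (-(ε * (inverseSubordinator T a ω : ℝ))))) ω ∂P := by
        refine lintegral_congr fun ω => ?_
        by_cases hω : ω ∈ A
        · simp only [Set.indicator_of_mem hω]
          rw [← ENNReal.ofReal_mul (hpos _ _ _), ← ENNReal.ofReal_mul (hpos _ _ _), ← mul_assoc,
            timeChangedExponential_eq, timeChangedExponential_eq, ← Real.exp_add]
          ring_nf
        · simp [Set.indicator_of_notMem hω]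
    _ = ∫⁻ ω, ENNReal.ofReal (timeChangedExponential B T (1 / 2) a ω) *
        A.indicator (fun ω => ENNReal.ofReal
          (Real.exp (-(ε * (inverseSubordinator T a ω : ℝ))))) ω ∂P :=
        (hswap _ (hE.ennreal_ofReal.indicator hA)).symm
    _ = _ := by
        refine lintegral_congr fun ω => ?_
        by_cases hω : ω ∈ A
        · simp only [Set.indicator_of_mem hω]
          rw [← ENNReal.ofReal_mul (hpos _ _ _)]
        · simp [Set.indicator_of_notMem hω]

lemma isProbabilityMeasure_tiltedMeasure [IsProbabilityMeasure P] (hB : IsBrownianMotion B P)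
    (hT : IsSubordinator T P)
    (hind : IndepFun (fun ω t => B t ω) (fun ω t => firstPassage T t ω) P)
    (hfin : ∀ t, ∀ᵐ ω ∂P, firstPassage T t ω ≠ ⊤)
    (a : ℝ≥0) {ε : ℝ} (hε : 0 ≤ ε) :
    IsProbabilityMeasure (tiltedMeasure P B T a ε) := by
  refine isProbabilityMeasure_tilted ?_
  simp only [exp_tilt_eq]
  exact integrable_timeChangedExponential_mul hB hT hind hfin _ a hε

lemma martingale_exp_tiltedMeasure [IsProbabilityMeasure P] (hB : IsBrownianMotion B P)
    (hT : IsSubordinator T P)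
    (hind : IndepFun (fun ω t => B t ω) (fun ω t => firstPassage T t ω) P)
    (hfin : ∀ t, ∀ᵐ ω ∂P, firstPassage T t ω ≠ ⊤)
    (a : ℝ≥0) {ε : ℝ} (hε : 0 ≤ ε) :
    Martingale (fun (t : Set.Icc (0 : ℝ≥0) a) ω => Real.exp (subdiffusion B T t ω))
      (restrictIcc (timeChangedFiltration hB hT) a) (tiltedMeasure P B T a ε) := by
  have hprob := isProbabilityMeasure_tiltedMeasure hB hT hind hfin a hε
  set g : Ω → ℝ := fun ω =>
    -(1 / 2) * subdiffusion B T a ω - (ε + 1 / 8) * (inverseSubordinator T a ω : ℝ)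
  set 𝓖 := timeChangedFiltration hB hT
  have hg : Integrable (fun ω => Real.exp (g ω)) P := by
    simp only [g, exp_tilt_eq]
    exact integrable_timeChangedExponential_mul hB hT hind hfin _ a hε
  have hX (t : ℝ≥0) : StronglyMeasurable[𝓖 t] fun ω => Real.exp (subdiffusion B T t ω) :=
    Real.continuous_exp.comp_stronglyMeasurable (stronglyAdapted_subdiffusion hB hT t)
  have hmeas (t : ℝ≥0) : AEStronglyMeasurable
      (fun ω => Real.exp (g ω) * Real.exp (subdiffusion B T t ω)) P :=
    hg.1.mul ((hX t).mono (𝓖.le t)).aestronglyMeasurable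
  have hnn (t : ℝ≥0) (ω : Ω) : 0 ≤ Real.exp (g ω) * Real.exp (subdiffusion B T t ω) := by
    positivity
  have hW := integrable_timeChangedExponential_mul hB hT hind hfin (1 / 2) a hε
  have hWnn (ω : Ω) : 0 ≤ timeChangedExponential B T (1 / 2) a ω *
      Real.exp (-(ε * (inverseSubordinator T a ω : ℝ))) :=
    mul_nonneg (timeChangedExponential_pos _ _ _).le (Real.exp_pos _).le
  have hint (t : ℝ≥0) (hta : t ≤ a) :
      Integrable (fun ω => Real.exp (g ω) * Real.exp (subdiffusion B T t ω)) P := by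
    refine ⟨hmeas t, ?_⟩
    have h := setLIntegral_tilt_mul_exp_eq hB hT hind hfin hta ε MeasurableSet.univ
    rw [setLIntegral_univ, setLIntegral_univ] at h
    rw [hasFiniteIntegral_iff_ofReal (Eventually.of_forall (hnn t)), h,
      ← hasFiniteIntegral_iff_ofReal (Eventually.of_forall hWnn)]
    exact hW.2
  -- The right-hand side is free of `t`, so for an event of `𝓖 s` the times `s` and `t` give the
  -- same value.
  have hset (t : ℝ≥0) (hta : t ≤ a) {A : Set Ω} (hA : MeasurableSet[𝓖 t] A) :
      ∫ ω in A, Real.exp (g ω) * Real.exp (subdiffusion B T t ω) ∂P =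
        ∫ ω in A, timeChangedExponential B T (1 / 2) a ω *
          Real.exp (-(ε * (inverseSubordinator T a ω : ℝ))) ∂P := by
    rw [integral_eq_lintegral_of_nonneg_ae (Eventually.of_forall (hnn t)) (hmeas t).restrict,
      integral_eq_lintegral_of_nonneg_ae (Eventually.of_forall hWnn) hW.1.restrict,
      setLIntegral_tilt_mul_exp_eq hB hT hind hfin hta ε hA]
  have htilt (t : ℝ≥0) (A : Set Ω) :
      ∫ ω in A, Real.exp (subdiffusion B T t ω) ∂(P.tilted g) =
        (∫ ω in A, Real.exp (g ω) * Real.exp (subdiffusion B T t ω) ∂P) /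
          ∫ ω, Real.exp (g ω) ∂P := by
    rw [setIntegral_tilted, ← integral_div]
    simp only [smul_eq_mul, div_mul_eq_mul_div]
  refine martingale_of_setIntegral_eq (fun t => hX t) (fun t => ?_) fun s t hst A hA => ?_
  · exact (integrable_tilted_iff hg _).2 (hint t t.2.2)
  · change ∫ ω in A, _ ∂(P.tilted g) = ∫ ω in A, _ ∂(P.tilted g)
    have hAt : MeasurableSet[𝓖 t] A := 𝓖.mono hst _ hA
    rw [htilt, htilt, hset t t.2.2 hAt, hset s s.2.2 hA]

end Martingales

end Subdiffusion

theorem theorem2p1 {Ω : Type*} {mΩ : MeasurableSpace Ω} (P : Measure Ω) [IsProbabilityMeasure P]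
    (B T : ℝ≥0 → Ω → ℝ) (ν : Measure ℝ)
    (hB : Subdiffusion.IsBrownianMotion B P)
    (hT : Subdiffusion.IsSubordinator T P)
    (hν : Subdiffusion.IsSubordinatorLevyMeasure ν)
    (hν_inf : ν (Set.Ioi 0) = ∞)
    (hf : Subdiffusion.HasLaplaceExponent T (Subdiffusion.laplaceExponent ν) P)
    (hind : IndepFun (fun ω t => B t ω) (fun ω t => Subdiffusion.firstPassage T t ω) P) :
    (Martingale (Subdiffusion.subdiffusion B T)
        (Subdiffusion.timeChangedFiltration hB hT) P ∧
      Martingale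
        (fun t ω => Real.exp (Subdiffusion.subdiffusion B T t ω
          - 1 / 2 * (Subdiffusion.inverseSubordinator T t ω : ℝ)))
        (Subdiffusion.timeChangedFiltration hB hT) P) ∧
    ∀ (a : ℝ≥0) (ε : ℝ), 0 ≤ ε →
      IsProbabilityMeasure (Subdiffusion.tiltedMeasure P B T a ε) ∧
      Martingale
        (fun (t : Set.Icc (0 : ℝ≥0) a) ω => Real.exp (Subdiffusion.subdiffusion B T t ω))
        (Subdiffusion.restrictIcc (Subdiffusion.timeChangedFiltration hB hT) a)
        (Subdiffusion.tiltedMeasure P B T a ε) := by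
  have hf1 : 0 < Subdiffusion.laplaceExponent ν 1 :=
    Subdiffusion.laplaceExponent_one_pos hν (by simp [hν_inf])
  have hfin := Subdiffusion.firstPassage_ne_top_ae hf hf1
  refine ⟨⟨Subdiffusion.martingale_subdiffusion hB hT hind hfin hf hf1, ?_⟩, fun a ε hε =>
    ⟨Subdiffusion.isProbabilityMeasure_tiltedMeasure hB hT hind hfin a hε,
      Subdiffusion.martingale_exp_tiltedMeasure hB hT hind hfin a hε⟩⟩
  have h := Subdiffusion.martingale_timeChangedExponential hB hT hind hfin 1
  have heq : Subdiffusion.timeChangedExponential B T 1 = fun t ω =>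
      Real.exp (Subdiffusion.subdiffusion B T t ω
        - 1 / 2 * (Subdiffusion.inverseSubordinator T t ω : ℝ)) := by
    ext t ω
    rw [Subdiffusion.timeChangedExponential_eq, one_mul, one_pow]
  rwa [heq] at h
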